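/- Let $k\ge 1$, write $\mathbb{R}^k=\mathbb{R}\times\mathbb{R}^{k-1}$ and let $\mathbb{S}_{k-1}\subset\mathbb{R}^k$ be the Euclidean unit sphere. A design on $\mathbb{S}_{k-1}$ is a Borel probability measure $\xi$ on $\mathbb{R}^k$ with $\xi(\mathbb{S}_{k-1})=1$. It is called invariant with respect to rotations of $x_2,\dots,x_k$ if its image under $(x_1,\tilde x)\mapsto(x_1,R\tilde x)$ is $\xi$ for every orthogonal $(k-1)\times(k-1)$ matrix $R$ with $\det R=1$; for $k=2$, where only $R=1$ has determinant one, the reflection $R=-1$ is also required. For $x_1\in[-1,1]$ let $\overline{\eta}(x_1,\cdot)$ be the uniform distribution (normalised surface measure) on the sphere of radius $\sqrt{1-x_1^2}$ about the origin in $\mathbb{R}^{k-1}$, which is the point mass at the origin if $x_1\in\{-1,1\}$; for $k=1$ let $\overline{\eta}(x_1,\cdot)$ be the point mass on the one-point space $\mathbb{R}^0$. Then: 1. $\overline{\eta}$ is a Markov kernel from $[-1,1]$ to $\mathbb{R}^{k-1}$. 2. A design $\xi$ on $\mathbb{S}_{k-1}$ is invariant with respect to rotations of $x_2,\dots,x_k$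 if and only if there is a probability measure $\xi_1$ on $[-1,1]$, namely the distribution of the first coordinate under $\xi$, such that $\xi=\xi_1\otimes\overline{\eta}$. 3. If $k\ge 2$, then for every probability measure $\xi_1$ on $[-1,1]$ the measure $\xi_1\otimes\overline{\eta}$ is a design on $\mathbb{S}_{k-1}$, is invariant with respect to rotations of $x_2,\dots,x_k$, and has first marginal $\xi_1$. -/

import Mathlib

open MeasureTheory ProbabilityTheory

namespace BallDesign

/-- `ℝᵐ` with the Euclidean norm. -/
abbrev E (m : ℕ) : Type := EuclideanSpace ℝ (Fin m)

/-- The point `(t, y₁, …, yₘ)` of `ℝᵐ⁺¹ = ℝ × ℝᵐ`. -/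
def glue {m : ℕ} (t : ℝ) (y : E m) : E (m + 1) :=
  WithLp.toLp 2 (Fin.cons t y.ofLp)

/-- The last `m` coordinates of a point of `ℝᵐ⁺¹`. -/
def tail {m : ℕ} (x : E (m + 1)) : E m :=
  WithLp.toLp 2 (fun i => x i.succ)

/-- The matrices acting as rotations of `ℝᵐ`: orthogonal matrices of determinant one. On the line
(`m = 1`), where only the identity has determinant one, the reflection `y ↦ -y` is included. -/
def IsRotationMatrix {m : ℕ} (R : Matrix (Fin m) (Fin m) ℝ) : Prop :=
  R ∈ Matrix.orthogonalGroup (Fin m) ℝ ∧ (m ≠ 1 → R.det = 1)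

/-- The map `(x₁, x₂, …, xₘ₊₁) ↦ (x₁, R (x₂, …, xₘ₊₁))`. -/
def actTail {m : ℕ} (R : Matrix (Fin m) (Fin m) ℝ) (x : E (m + 1)) : E (m + 1) :=
  glue (x 0) (WithLp.toLp 2 (R.mulVec (tail x).ofLp))

/-- A design on the unit sphere of `ℝⁿ`: a Borel probability measure concentrated on it. -/
def IsSphereDesign {n : ℕ} (ξ : Measure (E n)) : Prop :=
  IsProbabilityMeasure ξ ∧ ξ (Metric.sphere 0 1) = 1

/-- Invariance with respect to rotations of all coordinates but the first. -/
def IsTailInvariant {m : ℕ} (ξ : Measure (E (m + 1))) : Prop :=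
  ∀ R : Matrix (Fin m) (Fin m) ℝ, IsRotationMatrix R → ξ.map (actTail R) = ξ

/-- The uniform distribution on the unit sphere of `ℝᵐ`, `m ≥ 1`: normalised surface measure. -/
noncomputable def uniformUnitSphere (m : ℕ) : Measure (Metric.sphere (0 : E m) 1) :=
  ((volume : Measure (E m)).toSphere Set.univ)⁻¹ • (volume : Measure (E m)).toSphere

/-- The uniform distribution on the sphere of radius `r ≥ 0` about the origin of `ℝᵐ`; it is the
point mass at the origin if `r = 0`. In `ℝ⁰`, which is a single point, it is the point mass. -/
noncomputable def uniformSphere (m : ℕ) (r : ℝ) : Measure (E m) :=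
  if m = 0 then Measure.dirac 0
  else (uniformUnitSphere m).map (fun s : Metric.sphere (0 : E m) 1 => r • (s : E m))

instance (m : ℕ) : SFinite (uniformUnitSphere m) := by
  unfold uniformUnitSphere; infer_instance

theorem measurable_uniformSphere (m : ℕ) : Measurable (uniformSphere m) := by
  by_cases hm : m = 0
  · have : uniformSphere m = fun _ => Measure.dirac 0 := by
      funext r; simp [uniformSphere, hm]
    rw [this]; exact measurable_const
  · refine Measure.measurable_of_measurable_coe _ fun s hs => ?_
    have h : Measurable fun p : ℝ × Metric.sphere (0 : E m) 1 => p.1 • (p.2 : E m) := by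
      fun_prop
    have h2 : (fun r => uniformSphere m r s) = fun r => uniformUnitSphere m
        (Prod.mk r ⁻¹' ((fun p : ℝ × Metric.sphere (0 : E m) 1 => p.1 • (p.2 : E m)) ⁻¹' s)) := by
      funext r
      rw [uniformSphere, if_neg hm, Measure.map_apply (by fun_prop) hs]
      rfl
    rw [h2]
    exact measurable_measure_prodMk_left (h hs)

/-- The conditional design: `x₁ ∈ [-1, 1]` is sent to the uniform distribution on the sphere of
radius `√(1 - x₁²)` in `ℝᵐ`. -/
noncomputable def etaBar (m : ℕ) : Kernel (Set.Icc (-1 : ℝ) 1) (E m) where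
  toFun t := uniformSphere m (Real.sqrt (1 - (t : ℝ) ^ 2))
  measurable' := (measurable_uniformSphere m).comp (by fun_prop)

/-- The design `ξ₁ ⊗ η̄` on `ℝᵐ⁺¹ = ℝ × ℝᵐ`. -/
noncomputable def jointDesign (m : ℕ) (ξ₁ : Measure (Set.Icc (-1 : ℝ) 1)) :
    Measure (E (m + 1)) :=
  (ξ₁ ⊗ₘ etaBar m).map (fun p => glue (p.1 : ℝ) p.2)

/-- `ξ₁` is the distribution of the first coordinate under `ξ`. -/
def IsFirstMarginal {m : ℕ} (ξ₁ : Measure (Set.Icc (-1 : ℝ) 1)) (ξ : Measure (E (m + 1))) :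
    Prop :=
  ξ.map (fun x => x 0) = ξ₁.map (fun t : Set.Icc (-1 : ℝ) 1 => (t : ℝ))

end BallDesign

namespace BallDesign

/-! The rotations of the last `m` coordinates form a compact group, so they carry a Haar probability
measure. If `ξ` is invariant, then `ξ B` is the `ξ`-average over `x` of the mass that the randomly
rotated point `x` gives to `B` (`apply_eq_lintegral_of_forall_map_eq`). Rotations act transitively
on spheres, and the uniform distribution is invariant, so a Haar-random rotation of `y` is uniform
on the sphere of radius `‖y‖` (`map_rot_inv_eq_uniformSphere`). On the unit sphere the tail of `x`
has norm `√(1 - x₁²)`, so the averaged law depends on `x₁` alone and is `η̄(x₁, ·)` placed at height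
`x₁`. This is `ξ = ξ₁ ⊗ η̄`.

Conversely, `ξ₁ ⊗ η̄` is the image of a product of `ξ₁` with the uniform distribution under `(t, s)
↦ (t, √(1 - t²) s)`; rotations commute with the scaling and preserve the second factor. -/

/-- Averaging an invariant measure over a probability measure on the set of transformations. -/
theorem apply_eq_lintegral_of_forall_map_eq {G X : Type*} [MeasurableSpace G] [MeasurableSpace X]
    (h : Measure G) [IsProbabilityMeasure h] (ξ : Measure X) [SFinite ξ] {a : G → X → X}
    (ha : Measurable (Function.uncurry a)) (hξ : ∀ g, ξ.map (a g) = ξ) {B : Set X}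
    (hB : MeasurableSet B) : ξ B = ∫⁻ x, h.map (fun g => a g x) B ∂ξ := by
  have h1 : (h.prod ξ) (Function.uncurry a ⁻¹' B) = ξ B := by
    rw [Measure.prod_apply (ha hB)]
    have : ∀ g, ξ (Prod.mk g ⁻¹' (Function.uncurry a ⁻¹' B)) = ξ B := fun g => by
      have hg : Measurable (a g) := ha.comp measurable_prodMk_left
      conv_rhs => rw [← hξ g, Measure.map_apply hg hB]
      rfl
    simp [this]
  rw [← h1, Measure.prod_apply_symm (ha hB)]
  refine lintegral_congr fun x => ?_
  have hx : Measurable fun g => a g x := ha.comp measurable_prodMk_right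
  rw [Measure.map_apply hx hB]
  rfl

/-- An invariant probability measure concentrated on one orbit is the image of Haar measure. -/
theorem map_inv_eq_of_ae_mem_orbit {G X : Type*} [Group G] [MeasurableSpace G]
    [MeasurableMul G] [MeasurableSpace X] (h : Measure G) [IsProbabilityMeasure h]
    [h.IsMulLeftInvariant] {a : G → X → X} (hmul : ∀ g k x, a (g * k) x = a g (a k x))
    (ha : Measurable fun p : G × X => a p.1⁻¹ p.2) (σ : Measure X)
    [IsProbabilityMeasure σ] (hσ : ∀ g : G, σ.map (a g) = σ) (y : X)
    (hy : ∀ᵐ s ∂σ, ∃ g : G, a g y = s) : h.map (fun g : G => a g⁻¹ y) = σ := by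
  ext B hB
  rw [apply_eq_lintegral_of_forall_map_eq h σ (a := fun g x => a g⁻¹ x) ha (fun g => hσ g⁻¹) hB]
  have hconst : ∀ᵐ s ∂σ, h.map (fun g : G => a g⁻¹ s) B = h.map (fun g : G => a g⁻¹ y) B := by
    filter_upwards [hy] with s hs
    -- Since `g⁻¹ k = (k⁻¹ g)⁻¹`, moving the base point along its orbit is a left translation of
    -- `g`; acting by `g⁻¹` makes left invariance sufficient.
    obtain ⟨k, rfl⟩ := hs
    have hm : Measurable fun g : G => a g⁻¹ y := ha.comp measurable_prodMk_right
    have heq : (fun g : G => a g⁻¹ (a k y)) = (fun g : G => a g⁻¹ y) ∘ (k⁻¹ * ·) := by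
      funext g
      simp [hmul]
    rw [heq, ← Measure.map_map hm (measurable_const_mul _), map_mul_left_eq_self]
  rw [lintegral_congr_ae hconst]
  simp

/-! ### Rotation matrices and their action -/

/-- The linear action of a matrix on column vectors. -/
noncomputable def rot {m : ℕ} (R : Matrix (Fin m) (Fin m) ℝ) (y : E m) : E m :=
  WithLp.toLp 2 (R.mulVec y.ofLp)

/-- The rotation matrices as a subgroup of the group of orthogonal matrices. -/
def rotationSubgroup (m : ℕ) : Subgroup (Matrix.unitaryGroup (Fin m) ℝ) where
  carrier := {g | m ≠ 1 → (g : Matrix (Fin m) (Fin m) ℝ).det = 1}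
  one_mem' := by simp
  mul_mem' := by
    intro a b ha hb hm
    simp [ha hm, hb hm]
  inv_mem' := by
    intro a ha hm
    have : (a : Matrix (Fin m) (Fin m) ℝ).det * (a⁻¹ : Matrix.unitaryGroup (Fin m) ℝ).1.det = 1 := by
      rw [← Matrix.det_mul]
      have := congrArg Subtype.val (mul_inv_cancel a)
      simp only [Submonoid.coe_mul, Submonoid.coe_one] at this
      rw [this, Matrix.det_one]
    rwa [ha hm, one_mul] at this

theorem isRotationMatrix_coe {m : ℕ} (g : rotationSubgroup m) :
    IsRotationMatrix (g : Matrix (Fin m) (Fin m) ℝ) :=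
  ⟨g.1.2, g.2⟩

theorem isCompact_unitaryGroup (m : ℕ) :
    IsCompact (Matrix.unitaryGroup (Fin m) ℝ : Set (Matrix (Fin m) (Fin m) ℝ)) := by
  refine IsCompact.of_isClosed_subset
    (isCompact_univ_pi fun _ : Fin m => isCompact_univ_pi fun _ : Fin m =>
      isCompact_Icc (a := (-1 : ℝ)) (b := 1)) isClosed_unitary fun U hU => ?_
  exact fun i _ j _ => abs_le.mp (entry_norm_bound_of_unitary hU i j)

/-- Compactness allows Haar measure to be normalised to a probability measure. -/
instance (m : ℕ) : CompactSpace (rotationSubgroup m) := by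
  have : CompactSpace (Matrix.unitaryGroup (Fin m) ℝ) :=
    isCompact_iff_compactSpace.mp (isCompact_unitaryGroup m)
  refine isCompact_iff_compactSpace.mp (IsClosed.isCompact ?_)
  change IsClosed {g : Matrix.unitaryGroup (Fin m) ℝ |
    m ≠ 1 → (g : Matrix (Fin m) (Fin m) ℝ).det = 1}
  by_cases hm : m = 1
  · simp [hm]
  · simp only [ne_eq, hm, not_false_eq_true, true_implies]
    exact isClosed_eq continuous_subtype_val.matrix_det continuous_const

theorem rot_mul {m : ℕ} (R S : Matrix (Fin m) (Fin m) ℝ) (y : E m) :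
    rot (R * S) y = rot R (rot S y) := by
  simp [rot]

theorem rot_smul {m : ℕ} (R : Matrix (Fin m) (Fin m) ℝ) (r : ℝ) (y : E m) :
    rot R (r • y) = r • rot R y :=
  (Matrix.toEuclideanLin R).map_smul r y

theorem continuous_rot {m : ℕ} :
    Continuous fun p : Matrix (Fin m) (Fin m) ℝ × E m => rot p.1 p.2 := by
  unfold rot
  fun_prop

theorem norm_rot {m : ℕ} {R : Matrix (Fin m) (Fin m) ℝ}
    (hR : R ∈ Matrix.unitaryGroup (Fin m) ℝ) (y : E m) : ‖rot R y‖ = ‖y‖ := by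
  have hR' : R.transpose * R = 1 := Matrix.mem_unitaryGroup_iff'.mp hR
  have key (z : E m) : ‖z‖ ^ 2 = z.ofLp ⬝ᵥ z.ofLp := by
    rw [EuclideanSpace.real_norm_sq_eq]
    simp [dotProduct, sq]
  rw [← sq_eq_sq₀ (norm_nonneg _) (norm_nonneg _), key, key]
  simp only [rot]
  rw [Matrix.dotProduct_mulVec, Matrix.vecMul_mulVec, hR', Matrix.vecMul_one]

/-- An orthogonal matrix as a linear isometry. -/
noncomputable def rotIsometry {m : ℕ} (R : Matrix (Fin m) (Fin m) ℝ)
    (hR : R ∈ Matrix.unitaryGroup (Fin m) ℝ) : E m ≃ₗᵢ[ℝ] E m :=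
  LinearIsometry.toLinearIsometryEquiv ⟨Matrix.toEuclideanLin R, norm_rot hR⟩ rfl

/-- A linear isometry, of determinant one unless `m = 1`, is the action of a rotation matrix. -/
theorem exists_rot_eq_linearIsometryEquiv {m : ℕ} (e : E m ≃ₗᵢ[ℝ] E m)
    (he : m ≠ 1 → LinearMap.det (e.toLinearEquiv : E m →ₗ[ℝ] E m) = 1) :
    ∃ g : rotationSubgroup m, ∀ y, rot g.1.1 y = e y := by
  let b := EuclideanSpace.basisFun (Fin m) ℝ
  have hL (y : E m) : rot (LinearMap.toMatrix b.toBasis b.toBasis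
      (e.toLinearEquiv : E m →ₗ[ℝ] E m)) y = e y := by
    have := LinearMap.toMatrix_mulVec_repr b.toBasis b.toBasis
      (e.toLinearEquiv : E m →ₗ[ℝ] E m) y
    ext i
    exact congrFun this i
  refine ⟨⟨⟨_, e.toMatrix_mem_unitaryGroup b b⟩, fun hm => ?_⟩, hL⟩
  exact (LinearMap.det_toMatrix _ _).trans (he hm)

-- The reflection exchanging `u` and `v` has determinant `-1`. It is admissible on the line; for `m
-- ≥ 2` it is preceded by a second reflection, along some `w ⟂ u`, which fixes `u` and restores
-- determinant one.
open Submodule in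
theorem exists_rot_eq_of_norm_eq {m : ℕ} {u v : E m} (h : ‖u‖ = ‖v‖) :
    ∃ g : rotationSubgroup m, rot g.1.1 u = v := by
  rcases eq_or_ne u v with rfl | huv
  · exact ⟨1, by simp [rot]⟩
  have hr : (ℝ ∙ (u - v))ᗮ.reflection u = v := reflection_sub h
  by_cases hm : m = 1
  · obtain ⟨g, hg⟩ := exists_rot_eq_linearIsometryEquiv (ℝ ∙ (u - v))ᗮ.reflection
      (fun h => absurd hm h)
    exact ⟨g, (hg u).trans hr⟩
  have hfin : Module.finrank ℝ (ℝ ∙ u) < Module.finrank ℝ (E m) := by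
    have hu : u ≠ 0 := by
      rintro rfl
      exact huv (norm_eq_zero.mp (h.symm.trans norm_zero)).symm
    have : m ≠ 0 := by
      rintro rfl
      exact huv (Subsingleton.elim _ _)
    rw [finrank_span_singleton hu, finrank_euclideanSpace_fin]
    omega
  obtain ⟨w, hw, hw0⟩ : ∃ w ∈ (ℝ ∙ u)ᗮ, w ≠ 0 := by
    refine Submodule.exists_mem_ne_zero_of_ne_bot fun h0 => ?_
    have := (ℝ ∙ u).finrank_add_finrank_orthogonal
    rw [h0] at this
    simp only [finrank_bot] at this
    omega
  have hwu : (ℝ ∙ w)ᗮ.reflection u = u := by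
    refine reflection_mem_subspace_eq_self ?_
    rw [mem_orthogonal_singleton_iff_inner_right]
    rw [mem_orthogonal_singleton_iff_inner_left] at hw
    exact hw
  have hdet {x : E m} (hx : x ≠ 0) :
      LinearMap.det ((ℝ ∙ x)ᗮ.reflection.toLinearEquiv : E m →ₗ[ℝ] E m) = -1 := by
    refine (det_reflection _).trans ?_
    rw [orthogonal_orthogonal, finrank_span_singleton hx, pow_one]
  obtain ⟨g, hg⟩ := exists_rot_eq_linearIsometryEquiv
    ((ℝ ∙ w)ᗮ.reflection.trans (ℝ ∙ (u - v))ᗮ.reflection) (fun _ => by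
      have := LinearMap.det_comp ((ℝ ∙ (u - v))ᗮ.reflection.toLinearEquiv : E m →ₗ[ℝ] E m)
        ((ℝ ∙ w)ᗮ.reflection.toLinearEquiv : E m →ₗ[ℝ] E m)
      rw [hdet hw0, hdet (sub_ne_zero.mpr huv)] at this
      exact this.trans (by norm_num))
  refine ⟨g, (hg u).trans ?_⟩
  rw [LinearIsometryEquiv.trans_apply, hwu, hr]

/-! ### Uniform distributions on spheres -/

theorem isProbabilityMeasure_uniformUnitSphere {m : ℕ} (hm : m ≠ 0) :
    IsProbabilityMeasure (uniformUnitSphere m) := by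
  have : Nonempty (Fin m) := ⟨⟨0, Nat.pos_of_ne_zero hm⟩⟩
  refine ⟨?_⟩
  rw [uniformUnitSphere, Measure.smul_apply, smul_eq_mul]
  refine ENNReal.inv_mul_cancel ?_ (measure_ne_top _ _)
  rw [Measure.measure_univ_ne_zero]
  exact Measure.toSphere_ne_zero _

instance (m : ℕ) (r : ℝ) : IsProbabilityMeasure (uniformSphere m r) := by
  unfold uniformSphere
  split_ifs with hm
  · infer_instance
  · have := isProbabilityMeasure_uniformUnitSphere hm
    exact Measure.isProbabilityMeasure_map (by fun_prop)

theorem uniformSphere_eq_map (m : ℕ) (r : ℝ) :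
    uniformSphere m r = (uniformSphere m 1).map (r • ·) := by
  unfold uniformSphere
  split_ifs with hm
  · rw [Measure.map_dirac' (measurable_const_smul r), smul_zero]
  · rw [Measure.map_map (by fun_prop) (by fun_prop)]
    simp [Function.comp_def]

theorem ae_norm_uniformSphere_one {m : ℕ} (hm : m ≠ 0) :
    ∀ᵐ s ∂uniformSphere m 1, ‖s‖ = 1 := by
  rw [uniformSphere, if_neg hm, ae_map_iff (by fun_prop)
    (measurableSet_eq_fun (by fun_prop) (by fun_prop))]
  refine ae_of_all _ fun s => ?_
  simp

/-- Surface measure of a set is, up to a constant, the volume of the cone over it; a linear isometry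
carries cones to cones and preserves volume. -/
theorem map_uniformSphere_one_linearIsometryEquiv {m : ℕ} (e : E m ≃ₗᵢ[ℝ] E m) :
    (uniformSphere m 1).map e = uniformSphere m 1 := by
  by_cases hm : m = 0
  · rw [uniformSphere, if_pos hm, Measure.map_dirac' e.continuous.measurable, map_zero]
  ext B hB
  rw [Measure.map_apply (by fun_prop) hB]
  have hcoe : Measurable fun s : Metric.sphere (0 : E m) 1 => (s : E m) := by fun_prop
  have heB : MeasurableSet (e ⁻¹' B) := e.continuous.measurable hB
  simp only [uniformSphere, if_neg hm, one_smul]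
  rw [Measure.map_apply hcoe hB, Measure.map_apply hcoe heB]
  simp only [uniformUnitSphere, Measure.smul_apply]
  rw [Measure.toSphere_apply' _ (hcoe hB), Measure.toSphere_apply' _ (hcoe heB)]
  congr 2
  conv_rhs => rw [← e.measurePreserving.measure_preimage_equiv (f := e.toMeasurableEquiv)]
  congr 1
  ext y
  simp only [Set.mem_smul, Subtype.image_preimage_coe, Set.mem_inter_iff, Set.mem_preimage]
  constructor
  · rintro ⟨r, hr, x, ⟨hx, hxB⟩, rfl⟩
    exact ⟨r, hr, e x, ⟨by simpa using hx, hxB⟩, (map_smul e r x).symm⟩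
  · rintro ⟨r, hr, x, ⟨hx, hxB⟩, hy⟩
    refine ⟨r, hr, e.symm x, ⟨by simpa using hx, by simpa using hxB⟩, ?_⟩
    apply e.injective
    rw [map_smul, e.apply_symm_apply]
    exact hy

theorem map_uniformSphere_rot {m : ℕ} {R : Matrix (Fin m) (Fin m) ℝ}
    (hR : R ∈ Matrix.unitaryGroup (Fin m) ℝ) :
    (uniformSphere m 1).map (rot R) = uniformSphere m 1 :=
  map_uniformSphere_one_linearIsometryEquiv (rotIsometry R hR)

theorem continuous_rotationSubgroup_inv {m : ℕ} :
    Continuous fun g : rotationSubgroup m => (g⁻¹.1.1 : Matrix (Fin m) (Fin m) ℝ) :=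
  continuous_subtype_val.comp (continuous_subtype_val.comp continuous_inv)

theorem continuous_rot_inv {m : ℕ} :
    Continuous fun p : rotationSubgroup m × E m => rot p.1⁻¹.1.1 p.2 :=
  continuous_rot.comp ((continuous_rotationSubgroup_inv.comp continuous_fst).prodMk continuous_snd)

theorem measurable_rot_inv {m : ℕ} [MeasurableSpace (rotationSubgroup m)]
    [BorelSpace (rotationSubgroup m)] (y : E m) :
    Measurable fun g : rotationSubgroup m => rot g⁻¹.1.1 y :=
  Continuous.measurable (continuous_rot_inv.comp (g := fun p : rotationSubgroup m × E m =>
    rot p.1⁻¹.1.1 p.2) (Continuous.prodMk_left y))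

/-- Every orbit of the rotations, averaged over the group, carries the uniform distribution. -/
theorem map_rot_inv_eq_uniformSphere {m : ℕ} [MeasurableSpace (rotationSubgroup m)]
    [BorelSpace (rotationSubgroup m)] (h : Measure (rotationSubgroup m)) [IsProbabilityMeasure h]
    [h.IsMulLeftInvariant] (y : E m) :
    h.map (fun g => rot g⁻¹.1.1 y) = uniformSphere m ‖y‖ := by
  have hmeas := (continuous_rot_inv (m := m)).measurable
  -- For `y = 0` any unit vector serves as direction; `ℝ⁰` has none, hence the guard `m ≠ 0`.
  obtain ⟨s, hs, hsy⟩ : ∃ s : E m, (m ≠ 0 → ‖s‖ = 1) ∧ ‖y‖ • s = y := by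
    by_cases hm : m = 0
    · subst hm
      exact ⟨0, by simp, Subsingleton.elim _ _⟩
    have : Nonempty (Fin m) := ⟨⟨0, Nat.pos_of_ne_zero hm⟩⟩
    rcases eq_or_ne y 0 with rfl | hy
    · obtain ⟨s, hs⟩ := exists_norm_eq (E m) zero_le_one
      exact ⟨s, fun _ => hs, by simp⟩
    · have hy' : ‖y‖ ≠ 0 := norm_ne_zero_iff.mpr hy
      exact ⟨‖y‖⁻¹ • y, fun _ => by simp [norm_smul, hy'], by simp [smul_smul, hy']⟩
  have hone : h.map (fun g => rot g⁻¹.1.1 s) = uniformSphere m 1 := by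
    refine map_inv_eq_of_ae_mem_orbit (a := fun g => rot g.1.1) h
      (fun g k x => rot_mul g.1.1 k.1.1 x) hmeas _
      (fun g => map_uniformSphere_rot g.1.2) s ?_
    by_cases hm : m = 0
    · subst hm
      exact ae_of_all _ fun x => ⟨1, Subsingleton.elim _ _⟩
    · filter_upwards [ae_norm_uniformSphere_one hm] with x hx
      exact exists_rot_eq_of_norm_eq ((hs hm).trans hx.symm)
  rw [uniformSphere_eq_map, ← hone, Measure.map_map (measurable_const_smul _) (measurable_rot_inv s)]
  congr 1
  funext g
  conv_lhs => rw [← hsy]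
  exact rot_smul _ _ _

/-! ### First coordinate and tail -/

theorem continuous_glue {m : ℕ} : Continuous fun p : ℝ × E m => glue p.1 p.2 := by
  unfold glue
  fun_prop

theorem measurable_glue {m : ℕ} (t : ℝ) : Measurable (glue t : E m → E (m + 1)) :=
  continuous_glue.measurable.comp measurable_prodMk_left

theorem continuous_tail {m : ℕ} : Continuous (tail : E (m + 1) → E m) := by
  unfold tail
  fun_prop

@[simp]
theorem glue_zero {m : ℕ} (t : ℝ) (y : E m) : glue t y 0 = t := rfl

@[simp]
theorem tail_glue {m : ℕ} (t : ℝ) (y : E m) : tail (glue t y) = y := rfl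

theorem actTail_eq {m : ℕ} (R : Matrix (Fin m) (Fin m) ℝ) (x : E (m + 1)) :
    actTail R x = glue (x 0) (rot R (tail x)) := rfl

theorem continuous_actTail {m : ℕ} :
    Continuous fun p : Matrix (Fin m) (Fin m) ℝ × E (m + 1) => actTail p.1 p.2 := by
  have h0 : Continuous fun x : E (m + 1) => x 0 := by fun_prop
  exact continuous_glue.comp ((h0.comp continuous_snd).prodMk
    (continuous_rot.comp (continuous_fst.prodMk (continuous_tail.comp continuous_snd))))

theorem norm_sq_eq_add_norm_tail_sq {m : ℕ} (x : E (m + 1)) :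
    ‖x‖ ^ 2 = x 0 ^ 2 + ‖tail x‖ ^ 2 := by
  rw [EuclideanSpace.real_norm_sq_eq, EuclideanSpace.real_norm_sq_eq, Fin.sum_univ_succ]
  rfl

/-! ### The kernel and the joint design -/

instance (m : ℕ) : IsMarkovKernel (etaBar m) :=
  ⟨fun _ => inferInstanceAs (IsProbabilityMeasure (uniformSphere m _))⟩

theorem etaBar_apply (m : ℕ) (t : Set.Icc (-1 : ℝ) 1) :
    etaBar m t = uniformSphere m (Real.sqrt (1 - (t : ℝ) ^ 2)) := rfl

theorem measurable_glue_coe {m : ℕ} :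
    Measurable fun p : Set.Icc (-1 : ℝ) 1 × E m => glue (p.1 : ℝ) p.2 :=
  continuous_glue.measurable.comp ((measurable_subtype_coe.comp measurable_fst).prodMk measurable_snd)

theorem measurable_glue_sqrt_smul {m : ℕ} : Measurable fun p : Set.Icc (-1 : ℝ) 1 × E m =>
    glue (p.1 : ℝ) (Real.sqrt (1 - (p.1 : ℝ) ^ 2) • p.2) := by
  have h : Measurable fun t : Set.Icc (-1 : ℝ) 1 => Real.sqrt (1 - (t : ℝ) ^ 2) := by fun_prop
  exact continuous_glue.measurable.comp ((measurable_subtype_coe.comp measurable_fst).prodMk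
    ((h.comp measurable_fst).smul measurable_snd))

theorem jointDesign_apply (m : ℕ) (ξ₁ : Measure (Set.Icc (-1 : ℝ) 1)) [SFinite ξ₁]
    {B : Set (E (m + 1))} (hB : MeasurableSet B) :
    jointDesign m ξ₁ B = ∫⁻ t, (etaBar m t).map (glue (t : ℝ)) B ∂ξ₁ := by
  rw [jointDesign, Measure.map_apply measurable_glue_coe hB,
    Measure.compProd_apply (measurable_glue_coe hB)]
  refine lintegral_congr fun t => ?_
  rw [Measure.map_apply (measurable_glue t) hB]
  rfl

/-- The joint design as the image of a product measure. -/
theorem jointDesign_eq_map_prod (m : ℕ) (ξ₁ : Measure (Set.Icc (-1 : ℝ) 1)) [SFinite ξ₁] :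
    jointDesign m ξ₁ = (ξ₁.prod (uniformSphere m 1)).map
      (fun p => glue (p.1 : ℝ) (Real.sqrt (1 - (p.1 : ℝ) ^ 2) • p.2)) := by
  have hmeas := measurable_glue_sqrt_smul (m := m)
  ext B hB
  rw [jointDesign_apply m ξ₁ hB, Measure.map_apply hmeas hB, Measure.prod_apply (hmeas hB)]
  refine lintegral_congr fun t => ?_
  rw [etaBar_apply, uniformSphere_eq_map, Measure.map_map (measurable_glue t) (measurable_const_smul _),
    Measure.map_apply ((measurable_glue (t : ℝ)).comp (measurable_const_smul _)) hB]
  rfl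

instance (m : ℕ) (ξ₁ : Measure (Set.Icc (-1 : ℝ) 1)) [IsProbabilityMeasure ξ₁] :
    IsProbabilityMeasure (jointDesign m ξ₁) :=
  Measure.isProbabilityMeasure_map measurable_glue_coe.aemeasurable

theorem isFirstMarginal_jointDesign (m : ℕ) (ξ₁ : Measure (Set.Icc (-1 : ℝ) 1)) [SFinite ξ₁] :
    IsFirstMarginal ξ₁ (jointDesign m ξ₁) := by
  have h0 : Measurable fun x : E (m + 1) => x 0 := by fun_prop
  rw [IsFirstMarginal, jointDesign, Measure.map_map h0 measurable_glue_coe]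
  conv_rhs => rw [← Measure.fst_compProd ξ₁ (etaBar m), Measure.fst,
    Measure.map_map measurable_subtype_coe measurable_fst]
  rfl

theorem isTailInvariant_jointDesign (m : ℕ) (ξ₁ : Measure (Set.Icc (-1 : ℝ) 1)) [SFinite ξ₁] :
    IsTailInvariant (jointDesign m ξ₁) := by
  intro R hR
  have hmeas := measurable_glue_sqrt_smul (m := m)
  have hrot : Measurable (rot R) := (rotIsometry R hR.1).continuous.measurable
  have hact : Measurable (actTail R) :=
    (continuous_actTail.comp (Continuous.prodMk_right R)).measurable
  rw [jointDesign_eq_map_prod, Measure.map_map hact hmeas]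
  -- The uniform factor is replaced by its rotated image, which leaves only the commutation of `R`
  -- with scaling.
  conv_rhs => rw [← map_uniformSphere_rot hR.1, ← Measure.map_id (μ := ξ₁),
    Measure.map_prod_map _ _ measurable_id hrot,
    Measure.map_map hmeas (measurable_id.prodMap hrot)]
  congr 1
  funext p
  simp only [Function.comp_apply, actTail_eq, glue_zero, tail_glue, Prod.map_fst, Prod.map_snd, id]
  congr 1
  exact rot_smul _ _ _

/-- For `m = 0` this fails: the tail is always `0`, so `ξ₁` would have to live on `{-1, 1}`. -/
theorem isSphereDesign_jointDesign {m : ℕ} (hm : m ≠ 0) (ξ₁ : Measure (Set.Icc (-1 : ℝ) 1))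
    [IsProbabilityMeasure ξ₁] : IsSphereDesign (jointDesign m ξ₁) := by
  refine ⟨inferInstance, ?_⟩
  have hmeas := measurable_glue_sqrt_smul (m := m)
  have hS : MeasurableSet (Metric.sphere (0 : E (m + 1)) 1) := Metric.isClosed_sphere.measurableSet
  rw [← mem_ae_iff_prob_eq_one hS, jointDesign_eq_map_prod]
  refine (ae_map_iff hmeas.aemeasurable hS).mpr ?_
  have hae : ∀ᵐ p ∂ξ₁.prod (uniformSphere m 1), ‖p.2‖ = 1 :=
    Measure.quasiMeasurePreserving_snd.ae (ae_norm_uniformSphere_one hm)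
  filter_upwards [hae] with p hp
  have hp1 : (p.1 : ℝ) ^ 2 ≤ 1 := (sq_le_one_iff_abs_le_one _).mpr (abs_le.mpr p.1.2)
  refine mem_sphere_zero_iff_norm.mpr ?_
  rw [← sq_eq_sq₀ (norm_nonneg _) zero_le_one,
    norm_sq_eq_add_norm_tail_sq, glue_zero, tail_glue, norm_smul, hp, mul_one, Real.norm_eq_abs,
    sq_abs, Real.sq_sqrt (sub_nonneg.mpr hp1)]
  ring

/-- The first coordinate lies in `[-1, 1]` almost surely, so `Set.projIcc` only changes the
codomain. -/
theorem IsTailInvariant.eq_jointDesign {m : ℕ} {ξ : Measure (E (m + 1))} (hξ : IsSphereDesign ξ)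
    (hinv : IsTailInvariant ξ) :
    ξ = jointDesign m (ξ.map fun x => Set.projIcc (-1 : ℝ) 1 (by norm_num) (x 0)) := by
  have := hξ.1
  have hproj : Measurable fun x : E (m + 1) => Set.projIcc (-1 : ℝ) 1 (by norm_num) (x 0) :=
    continuous_projIcc.measurable.comp (by fun_prop)
  have hprob := Measure.isProbabilityMeasure_map (μ := ξ) hproj.aemeasurable
  borelize ↥(rotationSubgroup m)
  let h : Measure (rotationSubgroup m) := Measure.haarMeasure ⊤
  have hh : IsProbabilityMeasure h := ⟨Measure.haarMeasure_self⟩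
  have hact : Measurable (Function.uncurry fun (g : rotationSubgroup m) (x : E (m + 1)) =>
      actTail (g⁻¹ : rotationSubgroup m).1.1 x) :=
    (continuous_actTail.comp
      ((continuous_rotationSubgroup_inv.comp continuous_fst).prodMk continuous_snd)).measurable
  ext B hB
  rw [apply_eq_lintegral_of_forall_map_eq h ξ hact
    (fun g => hinv _ (isRotationMatrix_coe g⁻¹)) hB, jointDesign_apply m _ hB]
  have hker : Measurable fun t : Set.Icc (-1 : ℝ) 1 =>
      (etaBar m t).map (glue (t : ℝ)) B := by
    convert Kernel.measurable_kernel_prodMk_left (κ := etaBar m) (measurable_glue_coe hB) using 2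
    rw [Measure.map_apply (measurable_glue _) hB]
    rfl
  rw [lintegral_map hker hproj]
  refine lintegral_congr_ae ?_
  filter_upwards [(mem_ae_iff_prob_eq_one Metric.isClosed_sphere.measurableSet).mpr hξ.2] with x hx
  have hx1 : x 0 ^ 2 + ‖tail x‖ ^ 2 = 1 := by
    rw [← norm_sq_eq_add_norm_tail_sq, mem_sphere_zero_iff_norm.mp hx, one_pow]
  have hx0 : x 0 ∈ Set.Icc (-1 : ℝ) 1 :=
    abs_le.mp ((sq_le_one_iff_abs_le_one _).mp (by nlinarith [sq_nonneg ‖tail x‖]))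
  have hsqrt : Real.sqrt (1 - x 0 ^ 2) = ‖tail x‖ := by
    rw [← hx1, add_sub_cancel_left, Real.sqrt_sq (norm_nonneg _)]
  simp only [Set.projIcc_of_mem _ hx0]
  rw [etaBar_apply]
  simp only [hsqrt]
  rw [← map_rot_inv_eq_uniformSphere h, Measure.map_map (measurable_glue _) (measurable_rot_inv _)]
  rfl

end BallDesign

theorem mainTheorem6 (m : ℕ) :
    IsMarkovKernel (BallDesign.etaBar m) ∧
    (∀ ξ : Measure (BallDesign.E (m + 1)), BallDesign.IsSphereDesign ξ →
      (BallDesign.IsTailInvariant ξ ↔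
        ∃ ξ₁ : Measure (Set.Icc (-1 : ℝ) 1), IsProbabilityMeasure ξ₁ ∧
          BallDesign.IsFirstMarginal ξ₁ ξ ∧ ξ = BallDesign.jointDesign m ξ₁)) ∧
    (1 ≤ m → ∀ ξ₁ : Measure (Set.Icc (-1 : ℝ) 1), IsProbabilityMeasure ξ₁ →
      BallDesign.IsSphereDesign (BallDesign.jointDesign m ξ₁) ∧
      BallDesign.IsTailInvariant (BallDesign.jointDesign m ξ₁) ∧
      BallDesign.IsFirstMarginal ξ₁ (BallDesign.jointDesign m ξ₁)) := by
  refine ⟨inferInstance, fun ξ hξ => ⟨fun hinv => ?_, ?_⟩, fun hm ξ₁ hξ₁ => ?_⟩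
  · have := hξ.1
    have heq := hinv.eq_jointDesign hξ
    have hproj : Measurable fun x : BallDesign.E (m + 1) =>
        Set.projIcc (-1 : ℝ) 1 (by norm_num) (x 0) :=
      continuous_projIcc.measurable.comp (by fun_prop)
    have hprob := Measure.isProbabilityMeasure_map (μ := ξ) hproj.aemeasurable
    refine ⟨_, hprob, ?_, heq⟩
    have hmarg := BallDesign.isFirstMarginal_jointDesign m
      (ξ.map fun x => Set.projIcc (-1 : ℝ) 1 (by norm_num) (x 0))
    rwa [← heq] at hmarg
  · rintro ⟨ξ₁, hξ₁, -, rfl⟩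
    exact BallDesign.isTailInvariant_jointDesign m ξ₁
  · exact ⟨BallDesign.isSphereDesign_jointDesign (Nat.one_le_iff_ne_zero.mp hm) ξ₁,
      BallDesign.isTailInvariant_jointDesign m ξ₁, BallDesign.isFirstMarginal_jointDesign m ξ₁⟩
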